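/- For a first-order structure $N$ and $A\subseteq N$, let $\operatorname{acl}(A)$ denote the union of all finite subsets of $N$ that are definable in $N$ with parameters from $A$. Say that a structure $M$ has *trivial geometry* if in every structure $N$ elementarily equivalent to $M$ (in particular in $M$ itself and in all its elementary extensions) one has $$\operatorname{acl}(A)=\bigcup_{a\in A}\operatorname{acl}(\{a\})\qquad\text{for every nonempty } A\subseteq N .$$ Call a subset of $\mathbb C^n$ ($n\in\mathbb N$) a *constructible curve* if it is definable with parameters in the field $\mathbb C$ and has $\operatorname{acl}$-dimension at most $1$, where $\operatorname{acl}$ is taken in the field. Let $\mathcal C(\overline{\mathbb C}_{\mathbb C})$ be the structure with universe $\mathbb C$ and one $n$-ary predicate for each constructible curve in $\mathbb C^n$, for all $n$. Let $\mathcal B(\overline{\mathbb C}_{\mathbb C})$ be the structure with universe $\mathbb C$ and one binary predicate for each subset of $\mathbb C^2$ that is definable with parameters in the field $\mathbb C$. Then: 1. $\mathcal C(\overline{\mathbb C}_{\mathbb C})$ has trivial geometry. 2. $\mathcal B(\overline{\mathbb C}_{\mathbb C})$ is a reduct of $\mathcal C(\overline{\mathbb C}_{\mathbb C})$ in the sense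 of definability: every subset of $\mathbb C^n$ that is definable without parameters in $\mathcal B(\overline{\mathbb C}_{\mathbb C})$ is definable without parameters in $\mathcal C(\overline{\mathbb C}_{\mathbb C})$. 3. $\mathcal B(\overline{\mathbb C}_{\mathbb C})$ has trivial geometry. -/

import Mathlib

universe u v w

namespace CurveGeometry

/-- Model-theoretic algebraic closure: `x ∈ acl A` iff `x` lies in some finite subset of `M`
that is definable in `M` with parameters from `A`. -/
def acl (L : FirstOrder.Language.{u, v}) {M : Type w} [L.Structure M] (A : Set M) : Set M :=
  {x | ∃ S : Set M, A.Definable₁ L S ∧ S.Finite ∧ x ∈ S}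

/-- The field of complex numbers as a first-order structure in the language of rings. -/
noncomputable instance complexField : FirstOrder.Ring.CompatibleRing ℂ :=
  FirstOrder.Ring.compatibleRingOfRing ℂ

/-- `X ⊆ ℂⁿ` is definable (with parameters) in the field `ℂ` and has `acl`-dimension at most `d`.

The dimension of a set defined over `B` is the largest length of a subtuple
`(a_{i_0}, …, a_{i_{m-1}})` of a point `a` of the set, in a saturated extension of the field, such
that `a_{i_j} ∉ acl (B ∪ {a_{i_k} | k < j})` for all `j`. It depends neither on the parameters nor
on the saturated extension; as only finitely many parameters occur in a formula we take `B` finite,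
and as the field `ℂ` is itself saturated (an uncountable algebraically closed field) we take `ℂ`.
The empty set has dimension `-∞`. A sequence of indices with a repetition is never independent, and
by the exchange principle the order of the indices does not matter. -/
def DefinableOfDimLE {n : ℕ} (X : Set (Fin n → ℂ)) (d : ℕ) : Prop :=
  ∃ B : Set ℂ, B.Finite ∧ B.Definable FirstOrder.Language.ring X ∧
    ∀ a ∈ X, ∀ i : Fin (d + 1) → Fin n,
      ∃ j, a (i j) ∈ acl FirstOrder.Language.ring (B ∪ {c | ∃ k, k < j ∧ c = a (i k)})

/-- The (constructible) `n`-curves: subsets of `ℂⁿ` definable with parameters in the field `ℂ`, of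
dimension at most one. -/
def IsCurve {n : ℕ} (X : Set (Fin n → ℂ)) : Prop :=
  DefinableOfDimLE X 1

/-- The relational language with one `n`-ary predicate for each `n`-curve, for all `n`. -/
def curveLanguage : FirstOrder.Language.{0, 0} where
  Functions := fun _ => PEmpty
  Relations := fun n => {X : Set (Fin n → ℂ) // IsCurve X}

/-- The structure `𝒞(ℂ_ℂ)`: universe `ℂ`, each predicate interpreted by the curve it names. -/
instance curveStructure : curveLanguage.Structure ℂ where
  funMap := fun f _ => PEmpty.elim f
  RelMap := fun r x => x ∈ r.1

/-- The relational language with one binary predicate for each subset of `ℂ²` that is definable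
with parameters in the field `ℂ` (and no predicate of any other arity). -/
def binaryLanguage : FirstOrder.Language.{0, 0} where
  Functions := fun _ => PEmpty
  Relations := fun n =>
    {X : Set (Fin n → ℂ) // n = 2 ∧ (Set.univ : Set ℂ).Definable FirstOrder.Language.ring X}

/-- The structure `ℬ(ℂ_ℂ)`: universe `ℂ`, each predicate interpreted by the set it names. -/
instance binaryStructure : binaryLanguage.Structure ℂ where
  funMap := fun f _ => PEmpty.elim f
  RelMap := fun r x => x ∈ r.1

/-- The geometry of the `L`-structure `M` is trivial: in every structure `N` elementarily equivalent
to `M` (`M` itself, its elementary extensions, …), `acl A = ⋃ a ∈ A, acl {a}` for all nonempty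
`A ⊆ N`. Smaller models do not suffice: in a structure where every element is named by a predicate,
every element is in `acl ∅`. For `A = ∅` the union is empty, while `acl ∅` need not be. -/
def HasTrivialGeometry (L : FirstOrder.Language.{0, 0}) (M : Type) [L.Structure M] : Prop :=
  ∀ (N : Type w) [L.Structure N], L.ElementarilyEquivalent M N →
    ∀ A : Set N, A.Nonempty → acl L A = ⋃ a ∈ A, acl L {a}

end CurveGeometry

/-! ### Transcendence bases and automorphisms of ℂ. -/

namespace CurveGeometry

open Cardinal Algebra

/-! Write `cl` for field-theoretic algebraic closure and fix a finite B. All coordinates of a point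
on a curve over B lie in `cl (insert z B)` for one z. Hence a permutation of ℂ that swaps `cl
(insert x B)` with `cl (insert x' B)` through a field automorphism over `cl B`, and fixes everything
else, preserves every curve over B (`exists_perm_isCurveOver`). If x lies in a finite set defined by
a 𝒞-formula from y, but in no `cl (insert (y i) B)`, such permutations fix y and move x to
infinitely many x'. So x is field-algebraic over B and a single y i
(`exists_finite_forall_mem_cl_insert`).

This must pass to elementarily equivalent N. By countable saturation of ℂ, obtained from an
ultrapower, finitely many definable plane correspondences with bounded fibres witness the conclusion
for all y at once (`exists_finite_correspondences`). Both the covering and the fibre bounds are then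
first-order, and they transfer if the structure defines every definable subset of ℂ².

ℬ names those sets. 𝒞 defines them because independent pairs over B are conjugate, so a definable
plane set or its complement is a curve (`isCurve_or_isCurve_compl`). The same dichotomy translates
ℬ-formulas into 𝒞-formulas, so one argument serves both structures. -/

theorem exists_ringEquiv_of_isTranscendenceBasis {R K L ι : Type*} [CommRing R] [Field K] [Field L]
    [Algebra R K] [Algebra R L] [IsAlgClosed K] [IsAlgClosed L] {x : ι → K} {y : ι → L}
    (hx : IsTranscendenceBasis R x) (hy : IsTranscendenceBasis R y) :
    ∃ τ : K ≃+* L, (∀ r, τ (algebraMap R K r) = algebraMap R L r) ∧ ∀ i, τ (x i) = y i := by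
  have := IsAlgClosed.isAlgClosure_of_transcendence_basis x hx
  have := IsAlgClosed.isAlgClosure_of_transcendence_basis y hy
  let e : adjoin R (Set.range x) ≃ₐ[R] adjoin R (Set.range y) :=
    hx.1.aevalEquiv.symm.trans hy.1.aevalEquiv
  refine ⟨IsAlgClosure.equivOfEquiv K L e.toRingEquiv, fun r => ?_, fun i => ?_⟩
  · rw [IsScalarTower.algebraMap_apply R (adjoin R (Set.range x)) K,
      IsAlgClosure.equivOfEquiv_algebraMap, AlgEquiv.coe_ringEquiv,
      e.commutes, ← IsScalarTower.algebraMap_apply]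
  · have h1 : x i = algebraMap (adjoin R (Set.range x)) K (hx.1.aevalEquiv (MvPolynomial.X i)) := by
      simp
    rw [h1, IsAlgClosure.equivOfEquiv_algebraMap]
    simp [e]

/-- The transcendence matroid of `ℂ`, whose closure operator is field-theoretic algebraic
closure. -/
noncomputable abbrev cl (A : Set ℂ) : Set ℂ :=
  (AlgebraicIndependent.matroid ℤ ℂ).closure A

theorem mem_cl_iff {A : Set ℂ} {x : ℂ} : x ∈ cl A ↔ IsAlgebraic (adjoin ℤ A) x := by
  rw [cl, AlgebraicIndependent.matroid_closure_eq]
  rfl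

theorem countable_adjoin_int {K : Type*} [CommRing K] {C : Set K} (hC : C.Countable) :
    Countable (adjoin ℤ C) := by
  have := hC.to_subtype
  have h := Algebra.adjoin_range_eq_range_aeval ℤ ((↑) : C → K)
  rw [Subtype.range_coe] at h
  have : Countable (MvPolynomial C ℤ) := by
    rw [← mk_le_aleph0_iff]
    refine MvPolynomial.cardinalMk_le_max_lift.trans ?_
    simp
  rw [h]
  exact (AlgHom.rangeRestrict_surjective _).countable

theorem countable_cl {C : Set ℂ} (hC : C.Countable) : (cl C).Countable := by
  have := countable_adjoin_int hC
  have h := Algebraic.countable (adjoin ℤ C) ℂ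
  refine h.mono fun x hx => mem_cl_iff.1 hx

theorem infinite_compl_of_countable {C : Set ℂ} (hC : C.Countable) : Cᶜ.Infinite := by
  intro h
  have := hC.union h.countable
  rw [Set.union_compl_self] at this
  exact not_countable_complex this

theorem subset_cl (A : Set ℂ) : A ⊆ cl A :=
  Matroid.subset_closure _ _ (Set.subset_univ _)

theorem cl_mono {A B : Set ℂ} (h : A ⊆ B) : cl A ⊆ cl B :=
  Matroid.closure_subset_closure _ h

theorem cl_subset_cl {A B : Set ℂ} (h : A ⊆ cl B) : cl A ⊆ cl B :=
  Matroid.closure_subset_closure_of_subset_closure h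

theorem cl_exchange {A : Set ℂ} {x y : ℂ} (h : x ∈ cl (insert y A)) (hx : x ∉ cl A) :
    y ∈ cl (insert x A) :=
  (Matroid.closure_exchange ⟨h, hx⟩).1

theorem transcendental_adjoin_adjoin {C S : Set ℂ} {a : ℂ} (ha : a ∉ cl (C ∪ S)) :
    Transcendental (adjoin (adjoin ℤ C) S) a := by
  intro h
  refine ha (mem_cl_iff.2 ?_)
  have h' : IsAlgebraic ((adjoin (adjoin ℤ C) S).restrictScalars ℤ) a := h
  rwa [← Algebra.adjoin_union_eq_adjoin_adjoin] at h'

theorem algebraicIndepOn_pair {C : Set ℂ} {a b : ℂ} (ha : a ∉ cl C) (hb : b ∉ cl (insert a C)) :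
    AlgebraicIndepOn (adjoin ℤ C) id ({b, a} : Set ℂ) := by
  have h0 : AlgebraicIndepOn (adjoin ℤ C) id (∅ : Set ℂ) :=
    (algebraicIndependent_empty_iff _ _).2 (FaithfulSMul.algebraMap_injective _ _)
  have h1 : AlgebraicIndepOn (adjoin ℤ C) id ({a} : Set ℂ) := by
    have := h0.insert (i := a) (transcendental_adjoin_adjoin (by simpa using ha))
    simpa using this
  refine h1.insert (transcendental_adjoin_adjoin ?_)
  rw [Set.image_id, Set.union_singleton]
  exact hb

theorem mk_diff_eq_continuum {s t : Set ℂ} (ht : #t = 𝔠) (hs : s.Countable) :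
    #(t \ s : Set ℂ) = 𝔠 := by
  refine ((mk_le_mk_of_subset Set.sdiff_subset).trans ht.le).antisymm (not_lt.1 fun h => ?_)
  have h' := add_lt_of_lt aleph0_le_continuum h
    ((le_aleph0_iff_set_countable.2 hs).trans_lt aleph0_lt_continuum)
  exact absurd (ht ▸ (le_mk_sdiff_add_mk t s).trans_lt h') (lt_irrefl _)

theorem mk_transcendenceBasis {R : Type*} {ι K : Type} [CommRing R] [Nontrivial R] [Countable R] [Field K]
    [IsAlgClosed K] [Algebra R K] {x : ι → K} (hx : IsTranscendenceBasis R x) (hK : #K = 𝔠) :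
    #ι = 𝔠 := by
  have := IsAlgClosed.cardinal_eq_cardinal_transcendence_basis_of_aleph0_lt x hx mk_le_aleph0
    (by rw [hK]; exact aleph0_lt_continuum)
  simpa [hK] using this.symm

/-- After extending I and its image to transcendence bases over the countable ring generated by C,
both remainders have cardinality 𝔠; any bijection between them completes f to a bijection of bases.
-/
theorem exists_automorphism {C : Set ℂ} (hC : C.Countable) {I : Set ℂ} (hI : I.Countable)
    {f : ℂ → ℂ} (hf : Set.InjOn f I) (h1 : AlgebraicIndepOn (adjoin ℤ C) id I)
    (h2 : AlgebraicIndepOn (adjoin ℤ C) id (f '' I)) :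
    ∃ τ : ℂ ≃+* ℂ, (∀ c ∈ C, τ c = c) ∧ ∀ i ∈ I, τ i = f i := by
  classical
  have := countable_adjoin_int hC
  obtain ⟨s, hs, bs⟩ := exists_isTranscendenceBasis_superset h1
  obtain ⟨t, ht, bt⟩ := exists_isTranscendenceBasis_superset h2
  have cs := mk_diff_eq_continuum (mk_transcendenceBasis bs mk_complex) hI
  have ct := mk_diff_eq_continuum (mk_transcendenceBasis bt mk_complex) (hI.image f)
  obtain ⟨e⟩ := Cardinal.eq.1 (cs.trans ct.symm)
  let g : s ≃ t := (Equiv.Set.sumDiffSubset hs).symm.trans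
    ((Equiv.sumCongr (Equiv.Set.imageOfInjOn f I hf) e).trans (Equiv.Set.sumDiffSubset ht))
  obtain ⟨τ, h, h'⟩ := exists_ringEquiv_of_isTranscendenceBasis bs (bt.comp_equiv g)
  refine ⟨τ, fun c hc => h ⟨c, subset_adjoin hc⟩, fun i hi => ?_⟩
  rw [h' ⟨i, hs hi⟩]
  simp [g, Equiv.Set.sumDiffSubset_symm_apply_of_mem hs (x := ⟨i, hs hi⟩) hi,
    Equiv.Set.imageOfInjOn]

theorem exists_automorphism_pair {C : Set ℂ} (hC : C.Countable) {a b a' b' : ℂ} (ha : a ∉ cl C)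
    (hb : b ∉ cl (insert a C)) (ha' : a' ∉ cl C) (hb' : b' ∉ cl (insert a' C)) :
    ∃ τ : ℂ ≃+* ℂ, (∀ c ∈ C, τ c = c) ∧ τ a = a' ∧ τ b = b' := by
  classical
  have hab : b ≠ a := fun h => hb (h ▸ subset_cl _ (Set.mem_insert _ _))
  have hab' : b' ≠ a' := fun h => hb' (h ▸ subset_cl _ (Set.mem_insert _ _))
  let f : ℂ → ℂ := fun z => if z = a then a' else b'
  have hfa : f a = a' := if_pos rfl
  have hfb : f b = b' := if_neg hab
  have himg : f '' {b, a} = {b', a'} := by rw [Set.image_pair, hfa, hfb]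
  obtain ⟨τ, h, h'⟩ := exists_automorphism hC (Set.toFinite {b, a}).countable (f := f)
    (by
      rintro x (rfl | rfl) y (rfl | rfl) hxy
      · rfl
      · rw [hfa, hfb] at hxy; exact absurd hxy hab'
      · rw [hfa, hfb] at hxy; exact absurd hxy.symm hab'
      · rfl)
    (algebraicIndepOn_pair ha hb) (himg ▸ algebraicIndepOn_pair ha' hb')
  exact ⟨τ, h, hfa ▸ h' a (by simp), hfb ▸ h' b (by simp)⟩

end CurveGeometry

/-! ### Algebraic closure in the field: model theory agrees with algebra. -/

namespace CurveGeometry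

open FirstOrder Language Algebra

theorem mem_definable_iff_of_automorphism {B : Set ℂ} {α : Type*} {X : Set (α → ℂ)}
    (h : B.Definable Language.ring X) (τ : ℂ ≃+* ℂ) (hτ : ∀ b ∈ B, τ b = b) (v : α → ℂ) :
    τ ∘ v ∈ X ↔ v ∈ X := by
  obtain ⟨φ, rfl⟩ := Set.definable_iff_exists_formula_sum.1 h
  have h1 := StrongHomClass.realize_formula
    (FirstOrder.Ring.languageEquivEquivRingEquiv.symm τ) φ
    (v := Sum.elim (fun b : B => (b : ℂ)) v)
  rw [Set.mem_ofPred_eq, Set.mem_ofPred_eq, ← h1]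
  have h2 : Sum.elim (fun b : B => (b : ℂ)) (τ ∘ v) =
      (FirstOrder.Ring.languageEquivEquivRingEquiv.symm τ) ∘
        Sum.elim (fun b : B => (b : ℂ)) v := by
    funext i
    rcases i with b | i
    · exact (hτ b b.2).symm
    · rfl
  rw [h2]

theorem exists_freeCommRing_of_mem_adjoin {A : Set ℂ} {c : ℂ} (hc : c ∈ adjoin ℤ A) :
    ∃ q : FreeCommRing A, FreeCommRing.lift (fun a : A => (a : ℂ)) q = c := by
  induction hc using Algebra.adjoin_induction with
  | mem x hx => exact ⟨FreeCommRing.of ⟨x, hx⟩, by simp⟩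
  | algebraMap n => exact ⟨n, by simp⟩
  | add x y _ _ hx hy =>
    obtain ⟨p, rfl⟩ := hx
    obtain ⟨q, rfl⟩ := hy
    exact ⟨p + q, by simp⟩
  | mul x y _ _ hx hy =>
    obtain ⟨p, rfl⟩ := hx
    obtain ⟨q, rfl⟩ := hy
    exact ⟨p * q, by simp⟩

/-- Elements of a free commutative ring are realized by ring terms, so this makes the root set of p
definable over A. -/
theorem exists_freeCommRing_aeval {A : Set ℂ} (p : Polynomial (adjoin ℤ A)) :
    ∃ q : FreeCommRing (A ⊕ Fin 1), ∀ v : Fin 1 → ℂ,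
      FreeCommRing.lift (Sum.elim (fun a : A => (a : ℂ)) v) q = Polynomial.aeval (v 0) p := by
  induction p using Polynomial.induction_on' with
  | add p q hp hq =>
    obtain ⟨p', hp⟩ := hp
    obtain ⟨q', hq⟩ := hq
    exact ⟨p' + q', fun v => by simp [hp, hq]⟩
  | monomial n c =>
    obtain ⟨q, hq⟩ := exists_freeCommRing_of_mem_adjoin c.2
    refine ⟨FreeCommRing.lift (fun a => FreeCommRing.of (Sum.inl a)) q *
      FreeCommRing.of (Sum.inr 0) ^ n, fun v => ?_⟩
    have : (FreeCommRing.lift (Sum.elim (fun a : A => (a : ℂ)) v)).comp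
        (FreeCommRing.lift (fun a => FreeCommRing.of (Sum.inl a))) =
        FreeCommRing.lift (fun a : A => (a : ℂ)) := by
      ext; simp
    have h2 := RingHom.congr_fun this q
    rw [RingHom.comp_apply, hq] at h2
    simp [h2, Polynomial.aeval_monomial]

theorem cl_subset_acl (A : Set ℂ) : cl A ⊆ acl Language.ring A := by
  intro x hx
  obtain ⟨p, hp, hpx⟩ := mem_cl_iff.1 hx
  obtain ⟨q, hq⟩ := exists_freeCommRing_aeval p
  refine ⟨{z | Polynomial.aeval z p = 0}, ?_, ?_, hpx⟩
  · refine Set.definable_iff_exists_formula_sum.2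
      ⟨Term.equal (FirstOrder.Ring.termOfFreeCommRing q) 0, ?_⟩
    ext v
    simp [Formula.realize_equal, hq]
  · refine (p.rootSet_finite ℂ).subset fun z hz => ?_
    exact (Polynomial.mem_rootSet_of_ne hp).2 hz

theorem acl_eq_cl {A : Set ℂ} (hA : A.Countable) : acl Language.ring A = cl A := by
  refine Set.Subset.antisymm (fun x ⟨S, hS, hfin, hx⟩ => ?_) (cl_subset_acl A)
  by_contra hxA
  refine infinite_compl_of_countable ((countable_cl hA).union (countable_cl hA)) (hfin.subset ?_)
  intro x' hx'
  simp only [Set.union_self, Set.mem_compl_iff] at hx'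
  -- The elements b and b' are padding: only the conjugacy of x and x' over A is wanted, but the
  -- available lemma moves pairs.
  obtain ⟨b, hb⟩ := (infinite_compl_of_countable (countable_cl (hA.insert x))).nonempty
  obtain ⟨b', hb'⟩ := (infinite_compl_of_countable (countable_cl (hA.insert x'))).nonempty
  obtain ⟨τ, hτ, h, -⟩ := exists_automorphism_pair hA hxA hb hx' hb'
  have := (mem_definable_iff_of_automorphism hS τ hτ (fun _ => x)).2 hx
  simpa [h] using this

end CurveGeometry

/-! ### Curves and the generic type of the plane. -/

namespace CurveGeometry

open FirstOrder Language

/-- `X` is definable over `B`, and no point of `X` has two coordinates that are independent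
over `B`. -/
def IsCurveOver (B : Set ℂ) {n : ℕ} (X : Set (Fin n → ℂ)) : Prop :=
  B.Definable Language.ring X ∧
    ∀ a ∈ X, ∀ i j, a i ∉ cl B → a j ∈ cl (insert (a i) B)

theorem union_coords_zero {α : Type*} (B : Set α) (f : Fin 2 → α) :
    B ∪ {c | ∃ k, k < (0 : Fin 2) ∧ c = f k} = B := by
  ext; simp

theorem union_coords_one {α : Type*} (B : Set α) (f : Fin 2 → α) :
    B ∪ {c | ∃ k, k < (1 : Fin 2) ∧ c = f k} = insert (f 0) B := by
  ext
  simp [or_comm]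

theorem isCurve_iff {n : ℕ} {X : Set (Fin n → ℂ)} :
    IsCurve X ↔ ∃ B : Set ℂ, B.Finite ∧ IsCurveOver B X := by
  refine exists_congr fun B => and_congr_right fun hB => and_congr_right fun _ => ?_
  refine forall₂_congr fun a _ => ⟨fun h i j hi => ?_, fun h i => ?_⟩
  · obtain ⟨k, hk⟩ := h ![i, j]
    fin_cases k
    · refine absurd ?_ hi
      rw [← acl_eq_cl hB.countable]
      simpa using hk
    · rw [← acl_eq_cl (hB.insert _).countable]
      have := union_coords_one B (fun k => a (![i, j] k))
      simp only [Fin.mk_one] at hk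
      rw [this] at hk
      simpa using hk
  · by_cases hi : a (i 0) ∈ cl B
    · refine ⟨0, ?_⟩
      rw [← acl_eq_cl hB.countable] at hi
      rwa [union_coords_zero B (fun k => a (i k))]
    · refine ⟨1, ?_⟩
      have := h (i 0) (i 1) hi
      rw [← acl_eq_cl (hB.insert _).countable] at this
      rwa [union_coords_one B (fun k => a (i k))]

theorem IsCurveOver.mono {B B' : Set ℂ} (h : B ⊆ B') {n : ℕ} {X : Set (Fin n → ℂ)}
    (hX : IsCurveOver B X) : IsCurveOver B' X :=
  ⟨hX.1.mono h, fun a ha i j hi =>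
    cl_mono (Set.insert_subset_insert h) (hX.2 a ha i j fun hi' => hi (cl_mono h hi'))⟩

theorem exists_indep_of_not_isCurveOver {B : Set ℂ} {X : Set (Fin 2 → ℂ)}
    (hX : B.Definable Language.ring X) (h : ¬ IsCurveOver B X) :
    ∃ a ∈ X, a 0 ∉ cl B ∧ a 1 ∉ cl (insert (a 0) B) := by
  have h' : ¬ ∀ a ∈ X, ∀ i j, a i ∉ cl B → a j ∈ cl (insert (a i) B) := fun h' => h ⟨hX, h'⟩
  push Not at h'
  obtain ⟨a, ha, i, j, hi, hj⟩ := h'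
  refine ⟨a, ha, ?_⟩
  fin_cases i <;> fin_cases j <;> simp only [Fin.zero_eta, Fin.mk_one] at hi hj
  · exact absurd (subset_cl _ (Set.mem_insert _ _)) hj
  · exact ⟨hi, hj⟩
  -- The independent pair comes in the order (a 1, a 0); exchange reverses it.
  · exact ⟨fun h0 => hj (cl_mono (Set.subset_insert _ _) h0),
      fun h1 => hj (cl_exchange h1 hi)⟩
  · exact absurd (subset_cl _ (Set.mem_insert _ _)) hj

/-- The affine plane has a unique generic type. -/
theorem isCurve_or_isCurve_compl {X : Set (Fin 2 → ℂ)}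
    (hX : (Set.univ : Set ℂ).Definable Language.ring X) : IsCurve X ∨ IsCurve Xᶜ := by
  obtain ⟨B, -, hB⟩ := Set.definable_iff_finitely_definable.1 hX
  by_contra! h
  obtain ⟨a, ha, h0, h1⟩ := exists_indep_of_not_isCurveOver hB
    fun h' => h.1 (isCurve_iff.2 ⟨B, B.finite_toSet, h'⟩)
  obtain ⟨b, hb, h0', h1'⟩ := exists_indep_of_not_isCurveOver hB.compl
    fun h' => h.2 (isCurve_iff.2 ⟨B, B.finite_toSet, h'⟩)
  obtain ⟨τ, hτ, e0, e1⟩ := exists_automorphism_pair B.finite_toSet.countable h0 h1 h0' h1'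
  have hab : τ ∘ a = b := by
    funext i
    fin_cases i
    · exact e0
    · exact e1
  exact hb (hab ▸ (mem_definable_iff_of_automorphism hB τ hτ a).2 ha)

/-! ### Translating formulas between relational languages. -/

theorem realize_boundedFormula_zero_iff {L : Language} {M α : Type*} [L.Structure M]
    (φ : L.Formula α) (v : α → M) (xs : Fin 0 → M) :
    BoundedFormula.Realize φ v xs ↔ φ.Realize v := by
  rw [Formula.Realize, Subsingleton.elim xs default]

theorem exists_term_eq_var {L : Language} (hL : ∀ n, IsEmpty (L.Functions n)) {α : Type*}
    (t : L.Term α) : ∃ i, t = Term.var i := by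
  rcases t with i | ⟨f, _⟩
  · exact ⟨i, rfl⟩
  · exact (hL _).elim f

theorem curveLanguage_isEmpty_functions (n : ℕ) : IsEmpty (curveLanguage.Functions n) :=
  inferInstanceAs (IsEmpty PEmpty)

theorem curveLanguage_term_realize_comp {α : Type*} (t : curveLanguage.Term α) (σ : ℂ → ℂ)
    (w : α → ℂ) : t.realize (σ ∘ w) = σ (t.realize w) := by
  obtain ⟨i, rfl⟩ := exists_term_eq_var curveLanguage_isEmpty_functions t
  rfl

theorem exists_boundedFormula_translation {L L' : Language} {M : Type*} [L.Structure M]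
    [L'.Structure M] (hL : ∀ n, IsEmpty (L.Functions n))
    (h : ∀ n (r : L.Relations n), ∃ ψ : L'.Formula (Fin n),
      ∀ v : Fin n → M, ψ.Realize v ↔ Structure.RelMap r v)
    {α : Type*} {n : ℕ} (φ : L.BoundedFormula α n) :
    ∃ ψ : L'.BoundedFormula α n, ∀ (v : α → M) (xs : Fin n → M),
      ψ.Realize v xs ↔ φ.Realize v xs := by
  have hvar := fun {m} => exists_term_eq_var hL (α := α ⊕ Fin m)
  induction φ with
  | falsum => exact ⟨⊥, fun v xs => Iff.rfl⟩
  | equal t₁ t₂ =>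
    obtain ⟨i, rfl⟩ := hvar t₁
    obtain ⟨j, rfl⟩ := hvar t₂
    exact ⟨BoundedFormula.equal (Term.var i) (Term.var j), fun v xs => Iff.rfl⟩
  | @rel m l r ts =>
    obtain ⟨ψ, hψ⟩ := h _ r
    choose g hg using fun i => hvar (ts i)
    refine ⟨BoundedFormula.relabel (n := m) (k := 0) g ψ, fun v xs => ?_⟩
    rw [BoundedFormula.realize_relabel, realize_boundedFormula_zero_iff]
    have h1 := hψ (Sum.elim v xs ∘ g)
    have h2 : (fun i => (ts i).realize (Sum.elim v xs)) = Sum.elim v xs ∘ g := by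
      funext i; rw [hg]; rfl
    rw [BoundedFormula.Realize, h2, ← h1]
    rfl
  | imp _ _ h₁ h₂ =>
    obtain ⟨ψ₁, h₁⟩ := h₁
    obtain ⟨ψ₂, h₂⟩ := h₂
    exact ⟨ψ₁.imp ψ₂, fun v xs => by simp only [BoundedFormula.realize_imp, h₁, h₂]⟩
  | all _ h₁ =>
    obtain ⟨ψ₁, h₁⟩ := h₁
    exact ⟨ψ₁.all, fun v xs => by simp only [BoundedFormula.realize_all, h₁]⟩

theorem binaryLanguage_isEmpty_functions (n : ℕ) : IsEmpty (binaryLanguage.Functions n) :=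
  inferInstanceAs (IsEmpty PEmpty)

/-- The predicate of `curveLanguage` naming the curve `X`. -/
def curveRelation {n : ℕ} (X : Set (Fin n → ℂ)) (h : IsCurve X) : curveLanguage.Relations n :=
  ⟨X, h⟩

theorem realize_curveRelation_formula {n : ℕ} {X : Set (Fin n → ℂ)} (h : IsCurve X)
    (v : Fin n → ℂ) : ((curveRelation X h).formula Term.var).Realize v ↔ v ∈ X :=
  Formula.realize_rel

/-- The predicate of `binaryLanguage` naming the definable set `X`. -/
def binaryRelation (X : Set (Fin 2 → ℂ)) (h : (Set.univ : Set ℂ).Definable Language.ring X) :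
    binaryLanguage.Relations 2 :=
  ⟨X, rfl, h⟩

theorem realize_binaryRelation_formula {X : Set (Fin 2 → ℂ)}
    (h : (Set.univ : Set ℂ).Definable Language.ring X) (v : Fin 2 → ℂ) :
    ((binaryRelation X h).formula Term.var).Realize v ↔ v ∈ X :=
  Formula.realize_rel

theorem exists_curveLanguage_formula {α : Type*} (φ : binaryLanguage.Formula α) :
    ∃ ψ : curveLanguage.Formula α, ∀ v : α → ℂ, ψ.Realize v ↔ φ.Realize v := by
  have h : ∀ n (r : binaryLanguage.Relations n), ∃ ψ : curveLanguage.Formula (Fin n),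
      ∀ v : Fin n → ℂ, ψ.Realize v ↔ Structure.RelMap r v := by
    rintro n ⟨X, rfl, hX⟩
    rcases isCurve_or_isCurve_compl hX with h | h
    · exact ⟨(curveRelation X h).formula Term.var, realize_curveRelation_formula h⟩
    · refine ⟨((curveRelation Xᶜ h).formula Term.var).not, fun v => ?_⟩
      rw [Formula.realize_not, realize_curveRelation_formula]
      exact not_not
  obtain ⟨ψ, hψ⟩ := exists_boundedFormula_translation binaryLanguage_isEmpty_functions h φ
  exact ⟨ψ, fun v => by simpa only [realize_boundedFormula_zero_iff] using hψ v default⟩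

theorem definable_ring_of_curveLanguage {α : Type*} (φ : curveLanguage.Formula α) :
    (Set.univ : Set ℂ).Definable Language.ring {v : α → ℂ | φ.Realize v} := by
  have h : ∀ n (r : curveLanguage.Relations n),
      ∃ ψ : Language.ring[[(Set.univ : Set ℂ)]].Formula (Fin n),
        ∀ v : Fin n → ℂ, ψ.Realize v ↔ Structure.RelMap r v := by
    rintro n ⟨X, B, -, hX, -⟩
    obtain ⟨ψ, hψ⟩ := hX.mono (Set.subset_univ B)
    exact ⟨ψ, fun v => (Set.ext_iff.1 hψ v).symm⟩
  obtain ⟨ψ, hψ⟩ := exists_boundedFormula_translation curveLanguage_isEmpty_functions h φ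
  refine ⟨ψ, Set.ext fun v => ?_⟩
  have := (hψ v default).symm
  simp only [realize_boundedFormula_zero_iff] at this
  exact this

/-! ### Permutations of ℂ preserving the curves over a finite set. -/

/-- Only finitely many curves are named in a formula, so B can collect parameters for all of them.
Quantifiers are harmless because σ is bijective. -/
theorem exists_finite_forall_perm_realize_iff {α : Type*} {n : ℕ}
    (φ : curveLanguage.BoundedFormula α n) :
    ∃ B : Set ℂ, B.Finite ∧ ∀ σ : Equiv.Perm ℂ,
      (∀ (m : ℕ) (X : Set (Fin m → ℂ)), IsCurveOver B X → ∀ a, σ ∘ a ∈ X ↔ a ∈ X) →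
      ∀ (v : α → ℂ) (xs : Fin n → ℂ), φ.Realize (σ ∘ v) (σ ∘ xs) ↔ φ.Realize v xs := by
  induction φ with
  | falsum => exact ⟨∅, Set.finite_empty, fun σ _ v xs => Iff.rfl⟩
  | equal t₁ t₂ =>
    refine ⟨∅, Set.finite_empty, fun σ _ v xs => ?_⟩
    simp only [BoundedFormula.Realize, ← Sum.comp_elim, curveLanguage_term_realize_comp,
      EmbeddingLike.apply_eq_iff_eq]
  | rel r ts =>
    obtain ⟨B, hB, hX⟩ := isCurve_iff.1 r.2
    refine ⟨B, hB, fun σ hσ v xs => ?_⟩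
    simp only [BoundedFormula.Realize, ← Sum.comp_elim, curveLanguage_term_realize_comp]
    exact hσ _ _ hX _
  | imp _ _ h₁ h₂ =>
    obtain ⟨B₁, hB₁, h₁⟩ := h₁
    obtain ⟨B₂, hB₂, h₂⟩ := h₂
    refine ⟨B₁ ∪ B₂, hB₁.union hB₂, fun σ hσ v xs => ?_⟩
    simp only [BoundedFormula.Realize,
      h₁ σ fun m X hX => hσ m X (hX.mono Set.subset_union_left),
      h₂ σ fun m X hX => hσ m X (hX.mono Set.subset_union_right)]
  | all _ h =>
    obtain ⟨B, hB, h⟩ := h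
    refine ⟨B, hB, fun σ hσ v xs => ?_⟩
    simp only [BoundedFormula.Realize]
    rw [← σ.forall_congr_right]
    refine forall_congr' fun x => ?_
    rw [← Fin.comp_snoc, h σ hσ]

/-- Coordinates of a outside `cl B` are interalgebraic over B, so U contains all of them or none.
Thus σ acts on a as τ or as the identity. -/
theorem comp_mem_of_isCurveOver {B U : Set ℂ} {σ : ℂ → ℂ} {τ : ℂ ≃+* ℂ}
    (hτ : ∀ c ∈ cl B, τ c = c) (hU : ∀ z ∈ U, cl (insert z B) ⊆ U) (hσ : ∀ z ∈ U, σ z = τ z)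
    (hσ' : ∀ z ∉ U, σ z = z) {n : ℕ} {X : Set (Fin n → ℂ)} (hX : IsCurveOver B X)
    {a : Fin n → ℂ} (ha : a ∈ X) : σ ∘ a ∈ X := by
  have hfix : ∀ z ∈ cl B, σ z = z := fun z hz => by
    by_cases h : z ∈ U
    · rw [hσ z h, hτ z hz]
    · exact hσ' z h
  have key : σ ∘ a = a ∨ σ ∘ a = τ ∘ a := by
    by_cases hB : ∀ i, a i ∈ cl B
    · exact .inl (funext fun i => hfix _ (hB i))
    push Not at hB
    obtain ⟨i, hi⟩ := hB
    by_cases hiU : a i ∈ U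
    · exact .inr (funext fun j => hσ _ (hU _ hiU (hX.2 a ha i j hi)))
    · refine .inl (funext fun j => ?_)
      by_cases hj : a j ∈ cl B
      · exact hfix _ hj
      · exact hσ' _ fun hjU => hiU (hU _ hjU (hX.2 a ha j i hj))
  rcases key with h | h
  · rwa [h]
  · rw [h]
    exact (mem_definable_iff_of_automorphism hX.1 τ (fun b hb => hτ b (subset_cl B hb)) a).2 ha

theorem map_mem_cl {A A' : Set ℂ} (τ : ℂ ≃+* ℂ) (h : ∀ a ∈ A, τ a ∈ A') {z : ℂ} (hz : z ∈ cl A) :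
    τ z ∈ cl A' := by
  rw [mem_cl_iff] at hz ⊢
  have hmem : ∀ r : Algebra.adjoin ℤ A, τ r ∈ Algebra.adjoin ℤ A' := fun r => by
    have h1 : (Algebra.adjoin ℤ A).map (τ : ℂ →+* ℂ).toIntAlgHom ≤ Algebra.adjoin ℤ A' := by
      rw [AlgHom.map_adjoin]
      exact Algebra.adjoin_mono (by rintro _ ⟨a, ha, rfl⟩; exact h a ha)
    exact h1 ⟨r, r.2, rfl⟩
  let f : Algebra.adjoin ℤ A →+* Algebra.adjoin ℤ A' :=
    ((τ : ℂ →+* ℂ).comp (algebraMap (Algebra.adjoin ℤ A) ℂ)).codRestrict _ hmem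
  refine IsAlgebraic.ringHom_of_comp_eq f (τ : ℂ →+* ℂ) hz ?_ ?_
  · intro r s hrs
    exact Subtype.ext (τ.injective (congrArg Subtype.val hrs))
  · rfl

theorem cl_insert_subset {B : Set ℂ} {x z : ℂ} (hz : z ∈ cl (insert x B)) :
    cl (insert z B) ⊆ cl (insert x B) :=
  cl_subset_cl (Set.insert_subset hz ((Set.subset_insert _ _).trans (subset_cl _)))

theorem exists_perm_isCurveOver {B : Set ℂ} (hB : B.Finite) {x x' : ℂ} (hx : x ∉ cl B)
    (hx' : x' ∉ cl (insert x B)) :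
    ∃ σ : Equiv.Perm ℂ, σ x = x' ∧
      (∀ z, z ∈ cl B ∨ (z ∉ cl (insert x B) ∧ z ∉ cl (insert x' B)) → σ z = z) ∧
      ∀ (m : ℕ) (X : Set (Fin m → ℂ)), IsCurveOver B X → ∀ a, σ ∘ a ∈ X ↔ a ∈ X := by
  classical
  have hx'B : x' ∉ cl B := fun h => hx' (cl_mono (Set.subset_insert _ _) h)
  have hxx' : x ∉ cl (insert x' B) := fun h => hx' (cl_exchange h hx)
  have hcc : cl (cl B) = cl B := Matroid.closure_closure _ _
  have hci : ∀ z, cl (insert z (cl B)) = cl (insert z B) := fun z =>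
    Matroid.closure_insert_closure_eq_closure_insert _ _ _
  -- Working over `cl B` rather than B makes τ fix all of `cl B`. Swapping x and x', instead of just
  -- sending x to x', makes τ preserve U, so its restriction extends by the identity to a
  -- permutation.
  obtain ⟨τ, hτ, e, e'⟩ := exists_automorphism_pair (countable_cl hB.countable)
    (hcc.symm ▸ hx) ((hci x).symm ▸ hx') (hcc.symm ▸ hx'B) ((hci x').symm ▸ hxx')
  have hτs : ∀ c ∈ cl B, τ.symm c = c := fun c hc => by rw [RingEquiv.symm_apply_eq, hτ c hc]
  have es : τ.symm x' = x := by rw [← e, RingEquiv.symm_apply_apply]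
  have es' : τ.symm x = x' := by rw [← e', RingEquiv.symm_apply_apply]
  let U : Set ℂ := cl (insert x B) ∪ cl (insert x' B)
  have hmap : ∀ ρ : ℂ ≃+* ℂ, (∀ c ∈ cl B, ρ c = c) → ρ x = x' → ρ x' = x → ∀ z ∈ U, ρ z ∈ U := by
    rintro ρ hρ h1 h2 z (hz | hz)
    · refine .inr (map_mem_cl ρ ?_ hz)
      rintro a (rfl | ha)
      · rw [h1]; exact Set.mem_insert _ _
      · rw [hρ a (subset_cl B ha)]; exact Set.mem_insert_of_mem _ ha
    · refine .inl (map_mem_cl ρ ?_ hz)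
      rintro a (rfl | ha)
      · rw [h2]; exact Set.mem_insert _ _
      · rw [hρ a (subset_cl B ha)]; exact Set.mem_insert_of_mem _ ha
  have hU : ∀ z ∈ U, cl (insert z B) ⊆ U := by
    rintro z (hz | hz)
    · exact (cl_insert_subset hz).trans Set.subset_union_left
    · exact (cl_insert_subset hz).trans Set.subset_union_right
  have hτU : ∀ z, τ z ∈ U ↔ z ∈ U := fun z =>
    ⟨fun h => τ.symm_apply_apply z ▸ hmap τ.symm hτs es' es _ h, hmap τ hτ e e' z⟩
  let σ : Equiv.Perm ℂ := Equiv.Perm.ofSubtype (Equiv.Perm.subtypePerm (p := (· ∈ U)) τ.toEquiv hτU)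
  have hσ : ∀ z ∈ U, σ z = τ z := fun z hz => Equiv.Perm.ofSubtype_apply_of_mem _ hz
  have hσ' : ∀ z ∉ U, σ z = z := fun z hz => Equiv.Perm.ofSubtype_apply_of_not_mem _ hz
  have hσs : ∀ z ∈ U, σ.symm z = τ.symm z := fun z hz => by
    rw [Equiv.symm_apply_eq, hσ _ (hmap τ.symm hτs es' es _ hz), RingEquiv.apply_symm_apply]
  have hσs' : ∀ z ∉ U, σ.symm z = z := fun z hz => by
    rw [Equiv.symm_apply_eq, hσ' z hz]
  refine ⟨σ, ?_, ?_, fun m X hX a => ⟨fun h => ?_, fun h => ?_⟩⟩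
  · rw [hσ x (.inl (subset_cl _ (Set.mem_insert _ _))), e]
  · rintro z (hz | hz)
    · rw [hσ z (.inl (cl_mono (Set.subset_insert _ _) hz)), hτ z hz]
    · exact hσ' z fun h => h.elim hz.1 hz.2
  · have := comp_mem_of_isCurveOver hτs hU hσs hσs' hX h
    rwa [← Function.comp_assoc, Equiv.symm_comp_self, Function.id_comp] at this
  · exact comp_mem_of_isCurveOver hτ hU hσ hσ' hX h

/-- In `𝒞(ℂ_ℂ)` an element of a finite definable set is algebraic over a single parameter. -/
theorem exists_finite_forall_mem_cl_insert {ι : Type*} [Finite ι] [Nonempty ι]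
    (φ : curveLanguage.Formula (ι ⊕ Fin 1)) :
    ∃ B : Set ℂ, B.Finite ∧ ∀ (y : ι → ℂ), {x : ℂ | φ.Realize (Sum.elim y fun _ => x)}.Finite →
      ∀ x, φ.Realize (Sum.elim y fun _ => x) → ∃ i, x ∈ cl (insert (y i) B) := by
  obtain ⟨B, hB, h⟩ := exists_finite_forall_perm_realize_iff φ
  refine ⟨B, hB, fun y hfin x hx => ?_⟩
  by_contra! hxy
  have hxB : x ∉ cl B := fun h' =>
    hxy (Classical.arbitrary ι) (cl_mono (Set.subset_insert _ _) h')
  have hc : (cl (insert x B) ∪ ⋃ i, cl (insert (y i) B)).Countable :=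
    (countable_cl (hB.insert x).countable).union
      (Set.countable_iUnion fun i => countable_cl (hB.insert _).countable)
  refine infinite_compl_of_countable hc (hfin.subset fun x' hx' => ?_)
  simp only [Set.mem_compl_iff, Set.mem_union, Set.mem_iUnion, not_or, not_exists] at hx'
  obtain ⟨σ, hσx, hσ, hσX⟩ := exists_perm_isCurveOver hB hxB hx'.1
  -- By exchange, a parameter outside `cl B` but algebraic over x or x' would make that element
  -- algebraic over the parameter, contrary to the choice of x and x'.
  have hσy : ∀ i, σ (y i) = y i := fun i => by
    refine hσ _ (or_iff_not_imp_left.2 fun hi => ⟨fun h1 => ?_, fun h1 => ?_⟩)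
    · exact hxy i (cl_exchange h1 hi)
    · exact hx'.2 i (cl_exchange h1 hi)
  have h1 := (h σ hσX (Sum.elim y fun _ => x) default).2
    ((realize_boundedFormula_zero_iff _ _ _).2 hx)
  have h2 : σ ∘ (Sum.elim y fun _ : Fin 1 => x) = Sum.elim y fun _ => x' := by
    rw [Sum.comp_elim]
    congr 1
    · exact funext hσy
    · exact funext fun _ => hσx
  rw [h2] at h1
  exact (realize_boundedFormula_zero_iff _ _ _).1 h1

end CurveGeometry

/-! ### Countable saturation of ℂ through an ultrapower. -/

namespace CurveGeometry

open FirstOrder Language Algebra Cardinal Filter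

section Ultrapower

variable {I : Type} (u : Ultrafilter I)

/-- The ultrapower of the field `ℂ`. -/
abbrev Ultrapower : Type := (u : Filter I).Product fun _ => ℂ

instance model_ACF_ultrapower : (Theory.ACF 0).Model (Ultrapower u) := by
  refine ⟨fun φ hφ => ?_⟩
  rw [Ultraproduct.sentence_realize]
  exact Eventually.of_forall fun _ => Theory.realize_sentence_of_mem (Theory.ACF 0) hφ

noncomputable instance fieldUltrapower : Field (Ultrapower u) :=
  FirstOrder.Field.fieldOfModelACF 0 (Ultrapower u)

noncomputable instance compatibleRingUltrapower : FirstOrder.Ring.CompatibleRing (Ultrapower u) :=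
  have := FirstOrder.Field.modelField_of_modelACF 0 (Ultrapower u)
  FirstOrder.Field.compatibleRingOfModelField (Ultrapower u)

instance isAlgClosed_ultrapower : IsAlgClosed (Ultrapower u) :=
  FirstOrder.Field.isAlgClosed_of_model_ACF 0 (Ultrapower u)

/-- The diagonal embedding of `ℂ` in its ultrapower. -/
def diag (z : ℂ) : Ultrapower u := ((fun _ => z : I → ℂ) : (u : Filter I).Product fun _ => ℂ)

theorem diag_funMap {n : ℕ} (f : Language.ring.Functions n) (x : Fin n → ℂ) :
    diag u (Structure.funMap f x) = Structure.funMap f (fun i => diag u (x i)) :=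
  (Ultraproduct.funMap_cast f fun i _ => x i).symm

/-- The diagonal embedding as a ring homomorphism. -/
noncomputable def diagHom : ℂ →+* Ultrapower u where
  toFun := diag u
  map_one' := by
    have := diag_funMap u FirstOrder.Ring.oneFunc ![]
    simpa using this
  map_zero' := by
    have := diag_funMap u FirstOrder.Ring.zeroFunc ![]
    simpa using this
  map_add' x y := by
    have := diag_funMap u FirstOrder.Ring.addFunc ![x, y]
    simpa using this
  map_mul' x y := by
    have := diag_funMap u FirstOrder.Ring.mulFunc ![x, y]
    simpa using this

theorem mk_ultrapower [Countable I] : #(Ultrapower u) = 𝔠 := by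
  refine le_antisymm ?_ ?_
  · refine (mk_le_of_surjective (f := fun x : I → ℂ => (x : Ultrapower u))
      fun z => Quotient.inductionOn' z fun x => ⟨x, rfl⟩).trans ?_
    rw [← power_def, mk_complex]
    exact (power_le_power_left continuum_ne_zero mk_le_aleph0).trans continuum_power_aleph0.le
  · rw [← mk_complex]
    exact mk_le_of_injective (diagHom u).injective

/-- Steinitz: both fields are algebraically closed of cardinality 𝔠 over a countable ring. Points
found in the ultrapower can thus be brought back to ℂ over B. -/
theorem exists_ringEquiv_ultrapower [Countable I] {B : Set ℂ} (hB : B.Countable) :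
    ∃ τ : Ultrapower u ≃+* ℂ, ∀ b ∈ B, τ (diag u b) = b := by
  have := countable_adjoin_int hB
  let : Algebra (adjoin ℤ B) (Ultrapower u) := ((diagHom u).comp (algebraMap _ ℂ)).toAlgebra
  have : FaithfulSMul (adjoin ℤ B) (Ultrapower u) :=
    (faithfulSMul_iff_algebraMap_injective _ _).2
      ((diagHom u).injective.comp (FaithfulSMul.algebraMap_injective _ _))
  obtain ⟨s, hs⟩ := exists_isTranscendenceBasis (adjoin ℤ B) (Ultrapower u)
  obtain ⟨t, ht⟩ := exists_isTranscendenceBasis (adjoin ℤ B) ℂ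
  obtain ⟨e⟩ := Cardinal.eq.1 ((mk_transcendenceBasis hs (mk_ultrapower u)).trans
    (mk_transcendenceBasis ht mk_complex).symm)
  obtain ⟨τ, h, -⟩ := exists_ringEquiv_of_isTranscendenceBasis hs (ht.comp_equiv e)
  exact ⟨τ, fun b hb => h ⟨b, subset_adjoin hb⟩⟩

end Ultrapower

/-- The field `ℂ` is countably saturated over every countable set. -/
theorem exists_finite_cover {B : Set ℂ} (hB : B.Countable) {κ : Type} [Countable κ] {ι : Type*}
    {D : Set (ι → ℂ)} {E : κ → Set (ι → ℂ)} (hD : B.Definable Language.ring D)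
    (hE : ∀ k, B.Definable Language.ring (E k)) (h : D ⊆ ⋃ k, E k) :
    ∃ s : Finset κ, D ⊆ ⋃ k ∈ s, E k := by
  by_contra! hs
  -- The point `v s` escapes every `E k` with k in s. Since u contains each set of all s with k ∈ s,
  -- the class of v will lie in D but in no `E k`.
  choose v hvD hvE using fun s => Set.not_subset.1 (hs s)
  let u : Ultrafilter (Finset κ) := Ultrafilter.of atTop
  obtain ⟨τ, hτ⟩ := exists_ringEquiv_ultrapower u hB
  let w : ι → Ultrapower u := fun i => ((fun s => v s i : Finset κ → ℂ) : Ultrapower u)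
  -- Łoś's theorem, transported along τ, which respects the parameters in B.
  have key : ∀ X : Set (ι → ℂ), B.Definable Language.ring X →
      (τ ∘ w ∈ X ↔ ∀ᶠ s in u, v s ∈ X) := by
    intro X hX
    obtain ⟨φ, rfl⟩ := Set.definable_iff_exists_formula_sum.1 hX
    have h1 := Ultraproduct.realize_formula_cast (u := u) (M := fun _ => ℂ) φ
      (Sum.elim (fun (b : B) _ => (b : ℂ)) fun i s => v s i)
    have h2 := StrongHomClass.realize_formula
      (FirstOrder.Ring.languageEquivEquivRingEquiv.symm τ) φ
      (v := fun i => ((Sum.elim (fun (b : B) _ => (b : ℂ)) (fun i s => v s i) i :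
        Finset κ → ℂ) : Ultrapower u))
    have h3 := h2.trans h1
    refine Iff.trans (iff_of_eq ?_) (h3.trans (iff_of_eq ?_))
    · rw [Set.mem_ofPred_eq]
      congr 1
      funext i
      rcases i with b | i
      · exact (hτ b b.2).symm
      · rfl
    · congr 1
      funext s
      rw [Set.mem_ofPred_eq]
      congr 1
      funext i
      rcases i with b | i <;> rfl
  have hmem := (key D hD).2 (Eventually.of_forall hvD)
  obtain ⟨k, hk⟩ := Set.mem_iUnion.1 (h hmem)
  have h1 := (key _ (hE k)).1 hk
  have h2 : ∀ᶠ s : Finset κ in (u : Filter (Finset κ)), k ∈ s :=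
    (eventually_ge_atTop {k}).filter_mono (Ultrafilter.of_le _) |>.mono fun s hs =>
      Finset.singleton_subset_iff.1 hs
  obtain ⟨s, hs1, hs2⟩ := (h1.and h2).exists
  exact hvE s (Set.mem_biUnion hs2 hs1)

end CurveGeometry

/-! ### Uniform finiteness bounds and finitely many correspondences. -/

namespace CurveGeometry

open FirstOrder Language Cardinal

theorem sumElim_inl_inr_zero {α M : Type*} (v : α ⊕ Fin 1 → M) :
    Sum.elim (v ∘ Sum.inl) (fun _ => v (Sum.inr 0)) = v := by
  funext a
  rcases a with a | a
  · rfl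
  · rw [Subsingleton.elim a 0]; rfl

section AtMost

variable {L : Language} {M α : Type*} [L.Structure M]

/-- The formula stating that `φ` has at most `m` solutions in its last variable. -/
noncomputable def atMost (m : ℕ) (φ : L.Formula (α ⊕ Fin 1)) : L.Formula α :=
  Formula.iAlls (Fin (m + 1))
    ((Formula.iInf fun j : Fin (m + 1) => φ.relabel (Sum.map id fun _ => j)).imp
      (Formula.iSup fun p : {p : Fin (m + 1) × Fin (m + 1) // p.1 ≠ p.2} =>
        Term.equal (Term.var (Sum.inr p.1.1)) (Term.var (Sum.inr p.1.2))))

theorem realize_atMost {m : ℕ} {φ : L.Formula (α ⊕ Fin 1)} {v : α → M} :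
    (atMost m φ).Realize v ↔
      ∀ x : Fin (m + 1) → M, (∀ j, φ.Realize (Sum.elim v fun _ => x j)) →
        ∃ i j, i ≠ j ∧ x i = x j := by
  have h : ∀ (x : Fin (m + 1) → M) (j : Fin (m + 1)),
      (fun a => Sum.elim v x a) ∘ (Sum.map id fun _ : Fin 1 => j) = Sum.elim v fun _ => x j := by
    intro x j
    funext a
    rcases a with a | a <;> rfl
  simp [atMost, Formula.realize_iAlls, Formula.realize_imp, Formula.realize_relabel, h]

theorem exists_realize_atMost {φ : L.Formula (α ⊕ Fin 1)} {v : α → M}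
    (h : {x | φ.Realize (Sum.elim v fun _ => x)}.Finite) : ∃ m, (atMost m φ).Realize v := by
  have := h.fintype
  refine ⟨Fintype.card {x | φ.Realize (Sum.elim v fun _ => x)}, realize_atMost.2 fun x hx => ?_⟩
  obtain ⟨i, j, hij, e⟩ := Fintype.exists_ne_map_eq_of_card_lt
    (fun i => (⟨x i, hx i⟩ : {x | φ.Realize (Sum.elim v fun _ => x)}))
    (by rw [Fintype.card_fin]; exact Nat.lt_succ_self _)
  exact ⟨i, j, hij, congrArg Subtype.val e⟩

theorem finite_of_realize_atMost {m : ℕ} {φ : L.Formula (α ⊕ Fin 1)} {v : α → M}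
    (h : (atMost m φ).Realize v) : {x | φ.Realize (Sum.elim v fun _ => x)}.Finite := by
  by_contra hinf
  let f := Set.Infinite.natEmbedding _ hinf
  obtain ⟨i, j, hij, e⟩ := realize_atMost.1 h (fun i => f i) fun j => (f j).2
  exact hij (Fin.ext (f.injective (Subtype.ext e)))

theorem definable_insert_iff {A : Set M} {a : M} {S : Set (α → M)}
    (hS : (insert a A).Definable L S) :
    ∃ ψ : L[[A]].Formula (Fin 1 ⊕ α), ∀ v, v ∈ S ↔ ψ.Realize (Sum.elim (fun _ => a) v) := by
  classical
  obtain ⟨φ, rfl⟩ := Set.definable_iff_exists_formula_sum.1 hS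
  -- Every occurrence of a becomes the new variable, even if a already belongs to A.
  let g : (insert a A : Set M) ⊕ α → A ⊕ (Fin 1 ⊕ α) := Sum.elim
    (fun b => if h : b.1 = a then Sum.inr (Sum.inl 0)
      else Sum.inl ⟨b.1, b.2.resolve_left h⟩) (Sum.inr ∘ Sum.inr)
  obtain ⟨ψ, hψ⟩ := Set.definable_iff_exists_formula_sum.2
    ⟨φ.relabel g, (rfl : {w : Fin 1 ⊕ α → M | (φ.relabel g).Realize (Sum.elim (↑) w)} = _)⟩
  refine ⟨ψ, fun v => ?_⟩
  refine Iff.trans ?_ (Set.ext_iff.1 hψ (Sum.elim (fun _ => a) v))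
  rw [Set.mem_ofPred_eq, Set.mem_ofPred_eq, Formula.realize_relabel]
  refine iff_of_eq (congrArg _ (funext fun i => ?_))
  rcases i with b | i
  · by_cases h : b.1 = a <;> simp [g, h]
  · rfl

theorem realize_iAlls_relabel_inr_iff [Finite α] (χ : L.Formula α) :
    M ⊨ (Formula.iAlls α (χ.relabel (Sum.inr : α → Empty ⊕ α)) : L.Sentence) ↔
      ∀ v : α → M, χ.Realize v := by
  rw [Sentence.Realize, Formula.realize_iAlls]
  refine forall_congr' fun v => ?_
  rw [Formula.realize_relabel]
  rfl

theorem forall_realize_iff_of_elementarilyEquivalent {N : Type*} [L.Structure N] [Finite α]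
    (h : L.ElementarilyEquivalent M N) (χ : L.Formula α) :
    (∀ v : α → M, χ.Realize v) ↔ ∀ v : α → N, χ.Realize v := by
  rw [← realize_iAlls_relabel_inr_iff, ← realize_iAlls_relabel_inr_iff]
  exact elementarilyEquivalent_iff.1 h _

end AtMost

instance countable_ring_symbols : Countable Language.ring.Symbols :=
  Finite.to_countable

/-- A definable subset of the plane with fibres of size at most `m`. -/
def HasFibresAtMost (X : Set (Fin 2 → ℂ)) (m : ℕ) : Prop :=
  ∀ (b : ℂ) (x : Fin (m + 1) → ℂ), (∀ j, ![x j, b] ∈ X) → ∃ i j, i ≠ j ∧ x i = x j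

/-- The pairs `(x, y)` such that `ψ` holds of `(y, x)` and `ψ(y, ·)` has at most `m` solutions. -/
def boundedFibrePart {L : Language} [L.Structure ℂ] (ψ : L.Formula (Fin 1 ⊕ Fin 1)) (m : ℕ) :
    Set (Fin 2 → ℂ) :=
  {v | ψ.Realize (Sum.elim (fun _ => v 1) fun _ => v 0) ∧ (atMost m ψ).Realize fun _ => v 1}

theorem definable_boundedFibrePart {C : Set ℂ} (ψ : Language.ring[[C]].Formula (Fin 1 ⊕ Fin 1))
    (m : ℕ) : C.Definable Language.ring (boundedFibrePart ψ m) := by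
  refine ⟨ψ.relabel (Sum.elim (fun _ => 1) fun _ => 0) ⊓ (atMost m ψ).relabel fun _ => 1, ?_⟩
  ext v
  rw [Set.mem_ofPred_eq, Formula.realize_inf, Formula.realize_relabel, Formula.realize_relabel,
    Sum.comp_elim]
  rfl

theorem hasFibresAtMost_boundedFibrePart {L : Language} [L.Structure ℂ]
    (ψ : L.Formula (Fin 1 ⊕ Fin 1)) (m : ℕ) : HasFibresAtMost (boundedFibrePart ψ m) m :=
  fun _ x hx => realize_atMost.1 (hx 0).2 x fun j => (hx j).1

/-- Algebraicity of x over y is witnessed by a set whose fibres are bounded over every second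
coordinate, not only over y; that uniform bound is what transfers to N. -/
theorem exists_boundedFibrePart {C : Set ℂ} (hC : C.Countable) {x y : ℂ}
    (h : x ∈ cl (insert y C)) :
    ∃ (ψ : Language.ring[[C]].Formula (Fin 1 ⊕ Fin 1)) (m : ℕ), ![x, y] ∈ boundedFibrePart ψ m := by
  rw [← acl_eq_cl (hC.insert y)] at h
  obtain ⟨S, hS, hfin, hx⟩ := h
  obtain ⟨ψ, hψ⟩ := definable_insert_iff hS
  have hS' : {x | ψ.Realize (Sum.elim (fun _ => y) fun _ => x)} = S :=
    Set.ext fun z => (hψ fun _ => z).symm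
  obtain ⟨m, hm⟩ := exists_realize_atMost (hS'.symm ▸ hfin)
  exact ⟨ψ, m, (hψ fun _ => x).1 hx, hm⟩

/-- Finitely many definable correspondences with bounded fibres witness, uniformly in the
parameters, that an element of a finite definable set of `𝒞(ℂ_ℂ)` is algebraic over a single
parameter. -/
theorem exists_finite_correspondences {ι : Type} [Finite ι] [Nonempty ι]
    (φ : curveLanguage.Formula (ι ⊕ Fin 1)) (k : ℕ) :
    ∃ (J : Type) (_ : Finite J) (X : J → Set (Fin 2 → ℂ)) (m : J → ℕ),
      (∀ j, (Set.univ : Set ℂ).Definable Language.ring (X j)) ∧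
      (∀ j, HasFibresAtMost (X j) (m j)) ∧
      ∀ (y : ι → ℂ) (x : ℂ), φ.Realize (Sum.elim y fun _ => x) → (atMost k φ).Realize y →
        ∃ j i, ![x, y i] ∈ X j := by
  obtain ⟨B, hB, hφ⟩ := exists_finite_forall_mem_cl_insert φ
  -- Finiteness is not first-order, so the bound k is imposed to make D definable.
  let D : Set (ι ⊕ Fin 1 → ℂ) := {v | (φ ⊓ (atMost k φ).relabel Sum.inl).Realize v}
  obtain ⟨B', -, hB'⟩ := Set.definable_iff_finitely_definable.1
    (definable_ring_of_curveLanguage (φ ⊓ (atMost k φ).relabel Sum.inl))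
  let C : Set ℂ := B ∪ B'
  have hC : C.Countable := (hB.union B'.finite_toSet).countable
  have := hC.to_subtype
  -- All triples of a ring formula over C, a fibre bound and a parameter index form a countable
  -- cover of D; saturation leaves finitely many.
  obtain ⟨s, hs⟩ := exists_finite_cover hC
    (κ := (Language.ring[[C]].Formula (Fin 1 ⊕ Fin 1) × ℕ) × ι) (D := D)
    (E := fun p => (fun v => v ∘ ![Sum.inr 0, Sum.inl p.2]) ⁻¹' boundedFibrePart p.1.1 p.1.2)
    (hB'.mono Set.subset_union_right)
    (fun p => (definable_boundedFibrePart p.1.1 p.1.2).preimage_comp _) (by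
      intro v hv
      have hv' := Formula.realize_inf.1 hv
      rw [Formula.realize_relabel] at hv'
      obtain ⟨i, hi⟩ := hφ (v ∘ Sum.inl) (finite_of_realize_atMost hv'.2) (v (Sum.inr 0))
        (by rw [sumElim_inl_inr_zero]; exact hv'.1)
      obtain ⟨ψ, m, h⟩ := exists_boundedFibrePart hC
        (cl_mono (Set.insert_subset_insert Set.subset_union_left) hi)
      refine Set.mem_iUnion.2 ⟨((ψ, m), i), ?_⟩
      rw [Set.mem_preimage]
      convert h using 1
      funext j
      fin_cases j <;> rfl)
  refine ⟨s, inferInstance, fun p => boundedFibrePart p.1.1.1 p.1.1.2, fun p => p.1.1.2,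
    fun p => (definable_boundedFibrePart _ _).mono (Set.subset_univ _),
    fun p => hasFibresAtMost_boundedFibrePart _ _, fun y x h1 h2 => ?_⟩
  have hD : (Sum.elim y fun _ => x) ∈ D :=
    Formula.realize_inf.2 ⟨h1, Formula.realize_relabel.2 (by rwa [Sum.elim_comp_inl])⟩
  obtain ⟨p, hp, h⟩ := Set.mem_iUnion₂.1 (hs hD)
  refine ⟨⟨p, hp⟩, p.2, ?_⟩
  rw [Set.mem_preimage] at h
  convert h using 1
  funext j
  fin_cases j <;> rfl

end CurveGeometry

/-! ### Transfer to elementarily equivalent structures. -/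

namespace CurveGeometry

open FirstOrder Language

theorem acl_mono {L : Language} {M : Type*} [L.Structure M] {A B : Set M} (h : A ⊆ B) :
    acl L A ⊆ acl L B :=
  fun _ ⟨S, hS, hfin, hx⟩ => ⟨S, hS.mono h, hfin, hx⟩

theorem exists_formula_of_mem_acl {L : Language} {M : Type*} [L.Structure M] {A : Set M}
    (hA : A.Nonempty) {x : M} (hx : x ∈ acl L A) :
    ∃ (n : ℕ) (φ : L.Formula (Fin n ⊕ Fin 1)) (y : Fin n → M), Nonempty (Fin n) ∧
      (∀ i, y i ∈ A) ∧ {z | φ.Realize (Sum.elim y fun _ => z)}.Finite ∧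
      φ.Realize (Sum.elim y fun _ => x) := by
  classical
  obtain ⟨S, hS, hfin, hxS⟩ := hx
  obtain ⟨A₀, hA₀, hS⟩ := Set.definable_iff_finitely_definable.1 hS
  obtain ⟨a₀, ha₀⟩ := hA
  -- Adjoining a₀ guarantees at least one parameter, so that a set definable over ∅ is also handled.
  obtain ⟨φ, hφ⟩ := Set.definable_iff_exists_formula_sum.1
    (hS.mono (B := (insert a₀ A₀ : Finset M)) (by simp))
  let e := (insert a₀ A₀ : Finset M).equivFin
  have hS' : ∀ z, (φ.relabel (Sum.map e id)).Realize
      (Sum.elim (fun i => (e.symm i : M)) fun _ => z) ↔ z ∈ S := by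
    intro z
    rw [Formula.realize_relabel, Sum.elim_comp_map]
    have h1 : (fun i => (e.symm i : M)) ∘ e = Subtype.val :=
      funext fun b => congrArg Subtype.val (e.symm_apply_apply b)
    rw [h1]
    exact (Set.ext_iff.1 hφ fun _ => z).symm
  refine ⟨_, φ.relabel (Sum.map e id), fun i => e.symm i, ⟨e ⟨a₀, by simp⟩⟩, fun i => ?_,
    hfin.subset fun z hz => (hS' z).1 hz, (hS' x).2 hxS⟩
  rcases Finset.mem_insert.1 (e.symm i).2 with h | h
  · exact Set.mem_of_eq_of_mem h ha₀
  · exact hA₀ h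

/-- A structure on `ℂ` that is a reduct of `𝒞(ℂ_ℂ)` and in which every definable subset of the
affine plane is definable has trivial geometry. -/
theorem hasTrivialGeometry_of_reduct (L : FirstOrder.Language.{0, 0}) [L.Structure ℂ]
    (hL : ∀ (n : ℕ) (φ : L.Formula (Fin n ⊕ Fin 1)), ∃ ψ : curveLanguage.Formula (Fin n ⊕ Fin 1),
      ∀ v : Fin n ⊕ Fin 1 → ℂ, ψ.Realize v ↔ φ.Realize v)
    (hL' : ∀ X : Set (Fin 2 → ℂ), (Set.univ : Set ℂ).Definable Language.ring X →
      ∃ θ : L.Formula (Fin 2), ∀ v, θ.Realize v ↔ v ∈ X) :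
    HasTrivialGeometry.{w} L ℂ := by
  intro N _ hN A hA
  refine Set.Subset.antisymm (fun x hx => ?_)
    (Set.iUnion₂_subset fun a ha => acl_mono (Set.singleton_subset_iff.2 ha))
  obtain ⟨n, φ, y, _, hy, hfin, hx⟩ := exists_formula_of_mem_acl hA hx
  obtain ⟨k, hk⟩ := exists_realize_atMost hfin
  obtain ⟨ψ, hψ⟩ := hL _ φ
  obtain ⟨J, _, X, m, hX, hm, hXψ⟩ := exists_finite_correspondences ψ k
  choose θ hθ using fun j => hL' (X j) (hX j)
  -- First transferred sentence: the finitely many correspondences cover the solutions of φ whenever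
  -- there are at most k of them.
  have hcover := (forall_realize_iff_of_elementarilyEquivalent hN
    ((φ ⊓ (atMost k φ).relabel Sum.inl).imp (Formula.iSup fun p : J × _ =>
      (θ p.1).relabel ![Sum.inr 0, Sum.inl p.2]))).1 (fun v => by
    rw [Formula.realize_imp, Formula.realize_inf, Formula.realize_relabel, Formula.realize_iSup]
    rintro ⟨h1, h2⟩
    obtain ⟨j, i, hji⟩ := hXψ (v ∘ Sum.inl) (v (Sum.inr 0)) (by rwa [sumElim_inl_inr_zero, hψ])
      (by
        rw [realize_atMost] at h2 ⊢
        simpa only [hψ] using h2)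
    refine ⟨(j, i), ?_⟩
    rw [Formula.realize_relabel, hθ]
    convert hji using 1
    funext l
    fin_cases l <;> rfl) (Sum.elim y fun _ => x)
  rw [Formula.realize_imp, Formula.realize_inf, Formula.realize_relabel, Formula.realize_iSup,
    Sum.elim_comp_inl] at hcover
  obtain ⟨⟨j, i⟩, hji⟩ := hcover ⟨hx, hk⟩
  rw [Formula.realize_relabel] at hji
  -- Second transferred sentence: the fibres of correspondence j stay bounded in N, so its fibre
  -- over y i is the finite set placing x in the closure of that one parameter.
  have hfibre := (forall_realize_iff_of_elementarilyEquivalent hN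
    (atMost (m j) ((θ j).relabel ![Sum.inr 0, Sum.inl 0] : L.Formula (Fin 1 ⊕ Fin 1)))).1
    (fun v => realize_atMost.2 fun z hz => hm j (v 0) z fun l => by
      have := hz l
      rw [Formula.realize_relabel, hθ] at this
      convert this using 1
      funext l
      fin_cases l <;> rfl) (fun _ => y i)
  refine Set.mem_iUnion₂.2 ⟨y i, hy i, _, ?_, finite_of_realize_atMost hfibre, ?_⟩
  · refine Set.definable_iff_exists_formula_sum.2
      ⟨(θ j).relabel ![Sum.inr 0, Sum.inl ⟨y i, rfl⟩], ?_⟩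
    ext v
    rw [Set.mem_ofPred_eq, Set.mem_ofPred_eq, Set.mem_ofPred_eq, Formula.realize_relabel,
      Formula.realize_relabel]
    refine iff_of_eq (congrArg _ (funext fun l => ?_))
    fin_cases l <;> rfl
  · rw [Set.mem_ofPred_eq, Formula.realize_relabel]
    convert hji using 1
    funext l
    fin_cases l <;> rfl

end CurveGeometry

theorem corollary3p8 :
    CurveGeometry.HasTrivialGeometry.{w} CurveGeometry.curveLanguage ℂ ∧
    (∀ (n : ℕ) (S : Set (Fin n → ℂ)),
      (∅ : Set ℂ).Definable CurveGeometry.binaryLanguage S →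
        (∅ : Set ℂ).Definable CurveGeometry.curveLanguage S) ∧
    CurveGeometry.HasTrivialGeometry.{w} CurveGeometry.binaryLanguage ℂ := by
  refine ⟨CurveGeometry.hasTrivialGeometry_of_reduct _ (fun n φ => ⟨φ, fun v => Iff.rfl⟩)
    fun X hX => ?_, fun n S hS => ?_, CurveGeometry.hasTrivialGeometry_of_reduct _
      (fun n φ => CurveGeometry.exists_curveLanguage_formula φ)
      fun X hX => ⟨_, CurveGeometry.realize_binaryRelation_formula hX⟩⟩
  · obtain ⟨ψ, hψ⟩ := CurveGeometry.exists_curveLanguage_formula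
      ((CurveGeometry.binaryRelation X hX).formula FirstOrder.Language.Term.var)
    exact ⟨ψ, fun v => (hψ v).trans (CurveGeometry.realize_binaryRelation_formula hX v)⟩
  · obtain ⟨φ, rfl⟩ := Set.empty_definable_iff.1 hS
    obtain ⟨ψ, hψ⟩ := CurveGeometry.exists_curveLanguage_formula φ
    exact Set.empty_definable_iff.2 ⟨ψ, Set.ext fun v => (hψ v).symm⟩
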